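/- Let $G$ be a hereditarily normal topological group, that is, a topological group whose underlying space is $T_1$ and such that every subspace of $G$ is a normal topological space. Then every compact subset of $G$, with the subspace topology, is metrizable. -/

import Mathlib

open Set Filter Topology
open scoped Pointwise

/-! If `{1}` is a countable intersection of neighbourhoods, the diagonal of a compact `K` has a
countable neighbourhood base, so `K` is metrizable. An infinite `K` forces this. By translation, a
countable `B` accumulates at `1`, and complete normality puts a closed intersection subgroup `H`
inside the compact `closure B`. If `H` is infinite, it contains a nontrivial sequence tending to
`1`; the same separation argument applied to that sequence leaves only `{1}`. -/

/-- A decreasing sequence of closed symmetric neighbourhoods of the identity, each containing the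
square of the next one. -/
structure IsSquareRootSeq {G : Type*} [Group G] [TopologicalSpace G] (V : ℕ → Set G) : Prop where
  mem_nhds : ∀ n, V n ∈ 𝓝 1
  isClosed : ∀ n, IsClosed (V n)
  inv_eq : ∀ n, (V n)⁻¹ = V n
  mul_mem : ∀ n, ∀ x ∈ V (n + 1), ∀ y ∈ V (n + 1), x * y ∈ V n

namespace IsSquareRootSeq

variable {G : Type*} [Group G] [TopologicalSpace G] {V : ℕ → Set G}

theorem one_mem (h : IsSquareRootSeq V) (n : ℕ) : (1 : G) ∈ V n :=
  mem_of_mem_nhds (h.mem_nhds n)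

theorem antitone (h : IsSquareRootSeq V) : Antitone V :=
  antitone_nat_of_succ_le fun n x hx => by
    simpa using h.mul_mem n x hx 1 (h.one_mem _)

/-- The closed subgroup cut out by a square root sequence of neighbourhoods. -/
def core (h : IsSquareRootSeq V) : Subgroup G where
  carrier := ⋂ n, V n
  one_mem' := mem_iInter.2 h.one_mem
  mul_mem' := fun {x y} hx hy => mem_iInter.2 fun n =>
    h.mul_mem n x (mem_iInter.1 hx _) y (mem_iInter.1 hy _)
  inv_mem' := fun {x} hx => mem_iInter.2 fun n => by
    have := mem_iInter.1 hx n
    rw [← h.inv_eq n]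
    simpa using this

theorem mem_core (h : IsSquareRootSeq V) {x : G} : x ∈ h.core ↔ ∀ n, x ∈ V n := mem_iInter

theorem isClosed_core (h : IsSquareRootSeq V) : IsClosed (h.core : Set G) :=
  isClosed_iInter h.isClosed

end IsSquareRootSeq

section

variable {G : Type*} [Group G] [TopologicalSpace G] [IsTopologicalGroup G]

/-- Letting `F` see `V n` allows `V (n + 1)` to avoid a point chosen inside `V n`. -/
theorem exists_isSquareRootSeq (F : ℕ → Set G → Set G)
    (hF : ∀ n, ∀ U ∈ 𝓝 (1 : G), F n U ∈ 𝓝 1) :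
    ∃ V : ℕ → Set G, IsSquareRootSeq V ∧ ∀ n, V (n + 1) ⊆ F n (V n) := by
  have step : ∀ (n : ℕ) (U : {U : Set G // U ∈ 𝓝 1}), ∃ W : {U : Set G // U ∈ 𝓝 1},
      IsClosed W.1 ∧ W.1⁻¹ = W.1 ∧ (∀ x ∈ W.1, ∀ y ∈ W.1, x * y ∈ U.1) ∧ W.1 ⊆ F n U.1 := by
    intro n U
    obtain ⟨W, hW, hc, hi, hm⟩ :=
      exists_closed_nhds_one_inv_eq_mul_subset (inter_mem U.2 (hF n U.1 U.2))
    refine ⟨⟨W, hW⟩, hc, hi, fun x hx y hy => (hm (Set.mul_mem_mul hx hy)).1, fun x hx => ?_⟩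
    simpa using (hm (Set.mul_mem_mul hx (mem_of_mem_nhds hW))).2
  choose f hc hi hm hs using step
  let V : ℕ → {U : Set G // U ∈ 𝓝 1} := fun n => Nat.rec ⟨univ, univ_mem⟩ f n
  refine ⟨fun n => (V n).1, ⟨fun n => (V n).2, ?_, ?_, fun n => hm n (V n)⟩, fun n => hs n (V n)⟩
  · rintro (_ | n)
    · exact isClosed_univ
    · exact hc n (V n)
  · rintro (_ | n)
    · exact inv_univ
    · exact hi n (V n)

theorem exists_isSquareRootSeq_core_subset (O : ℕ → Set G) (hO : ∀ n, O n ∈ 𝓝 (1 : G)) :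
    ∃ (V : ℕ → Set G) (h : IsSquareRootSeq V), (h.core : Set G) ⊆ ⋂ n, O n := by
  obtain ⟨V, h, hV⟩ := exists_isSquareRootSeq (fun n _ => O n) fun n _ _ => hO n
  exact ⟨V, h, fun x hx => mem_iInter.2 fun n => hV n (h.mem_core.1 hx (n + 1))⟩

/-- In a completely normal group, if the identity is a limit point of a countable set `B`, then some
countable intersection of neighbourhoods of the identity is contained in `closure B \ B`. -/
theorem exists_iInter_nhds_one_subset_closure [T1Space G] [CompletelyNormalSpace G] {B : Set G}
    (hB : B.Countable) (h1 : (1 : G) ∈ closure B) (h1B : (1 : G) ∉ B) :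
    ∃ O : ℕ → Set G, (∀ n, O n ∈ 𝓝 (1 : G)) ∧ ⋂ n, O n ⊆ closure B \ B := by
  have hne : B.Nonempty := closure_nonempty_iff.1 ⟨1, h1⟩
  obtain ⟨b, rfl⟩ := hB.exists_eq_range hne
  obtain ⟨V, hV, hVb⟩ := exists_isSquareRootSeq_core_subset (fun n => {b n}ᶜ)
    fun n => isOpen_compl_singleton.mem_nhds fun h => h1B ⟨n, h.symm⟩
  have hHB : ∀ x ∈ hV.core, x ∉ range b := by
    rintro x hx ⟨n, rfl⟩
    exact mem_iInter.1 (hVb hx) n rfl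
  let H : Set G := hV.core
  have hsep := completely_normal (s := H \ closure (range b)) (t := range b)
    (Set.disjoint_left.2 fun x hx => hHB x (closure_minimal sdiff_subset hV.isClosed_core hx))
    (Set.disjoint_left.2 fun x hx => hx.2)
  obtain ⟨U, W, hUo, hWo, hU, hW, hd⟩ := separatedNhds_iff_disjoint.2 hsep
  refine ⟨fun n => V n ∩ (b n * ·) ⁻¹' W, fun n => inter_mem (hV.mem_nhds n) ?_, fun x hx => ?_⟩
  · refine (hWo.preimage (continuous_const_mul (b n))).mem_nhds ?_
    simpa using hW ⟨n, rfl⟩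
  · have hxH : x ∈ hV.core := hV.mem_core.2 fun n => (mem_iInter.1 hx n).1
    refine ⟨?_, hHB x hxH⟩
    -- Points `b n` close to `1` move `x` within `U`, yet `b n * x ∈ W` for every `n`.
    by_contra hxc
    have hxU : (1 : G) ∈ (· * x) ⁻¹' U := by simpa using hU ⟨hxH, hxc⟩
    obtain ⟨_, hy, n, rfl⟩ :=
      mem_closure_iff.1 h1 _ (hUo.preimage (continuous_mul_const x)) hxU
    exact Set.disjoint_left.1 hd hy (mem_iInter.1 hx n).2

end

/-! ### Convergent sequences in infinite compact groups -/

section CompactGroup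

variable {N : Type*} [Group N] [TopologicalSpace N]

/-- The sets `C n` are left cosets of the closed subgroup `L`, and converge to `L`. -/
structure CosetsTendsto (L : Subgroup N) (C : ℕ → Set N) : Prop where
  isClosed : IsClosed (L : Set N)
  nonempty : ∀ n, (C n).Nonempty
  mem_iff : ∀ n, ∀ x ∈ C n, ∀ y, y ∈ C n ↔ x⁻¹ * y ∈ L
  eventually_subset : ∀ O : Set N, IsOpen O → (L : Set N) ⊆ O → ∀ᶠ n in atTop, C n ⊆ O

variable [IsTopologicalGroup N]

theorem CosetsTendsto.isClosed_coset {L : Subgroup N} {C : ℕ → Set N} (h : CosetsTendsto L C)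
    (n : ℕ) : IsClosed (C n) := by
  obtain ⟨x, hx⟩ := h.nonempty n
  have : C n = (x⁻¹ * ·) ⁻¹' (L : Set N) := by
    ext y
    exact h.mem_iff n x hx y
  rw [this]
  exact h.isClosed.preimage (continuous_const_mul _)

theorem exists_selection_eventually_mem {X : Type*} {C V : ℕ → Set X} (hV : Antitone V)
    (hC : ∀ n, (C n).Nonempty) (h : ∀ k, ∀ᶠ n in atTop, (C n ∩ V k).Nonempty) :
    ∃ c : ℕ → X, (∀ n, c n ∈ C n) ∧ ∀ k, ∀ᶠ n in atTop, c n ∈ V k := by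
  have key : ∀ n, ∃ x ∈ C n, ∀ k ≤ n, (C n ∩ V k).Nonempty → x ∈ V k := by
    classical
    intro n
    by_cases hex : ∃ k ≤ n, (C n ∩ V k).Nonempty
    · obtain ⟨k, hk, hne⟩ := hex
      -- The deepest `V k` with `k ≤ n` that meets `C n` serves all shallower ones at once.
      obtain ⟨x, hx, hxV⟩ := Nat.findGreatest_spec (P := fun k => (C n ∩ V k).Nonempty) hk hne
      exact ⟨x, hx, fun j hj hjne => hV (Nat.le_findGreatest hj hjne) hxV⟩
    · push Not at hex
      obtain ⟨x, hx⟩ := hC n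
      exact ⟨x, hx, fun k hk hne => absurd hne (by simp [hex k hk])⟩
  choose c hc hcV using key
  refine ⟨c, hc, fun k => ?_⟩
  filter_upwards [h k, eventually_ge_atTop k] with n hn hkn using hcV n k hkn hn

variable [CompactSpace N] [T2Space N]

/-- Since `V k * L` is a neighbourhood of `L`, late cosets have representatives in `V k`. Pick these
ever closer to `1` and take their cosets of the smaller subgroup. -/
theorem CosetsTendsto.exists_refinement {L : Subgroup N} {C : ℕ → Set N}
    (h : CosetsTendsto L C) {V : ℕ → Set N} (hV : IsSquareRootSeq V) :
    ∃ C' : ℕ → Set N, CosetsTendsto (L ⊓ hV.core) C' ∧ ∀ n, C' n ⊆ C n := by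
  have hmeet : ∀ k, ∀ᶠ n in atTop, (C n ∩ V k).Nonempty := by
    intro k
    have hsub : (L : Set N) ⊆ interior (V k) * (L : Set N) := fun x hx =>
      ⟨1, mem_interior_iff_mem_nhds.2 (hV.mem_nhds k), x, hx, one_mul x⟩
    filter_upwards [h.eventually_subset _ isOpen_interior.mul_right hsub] with n hn
    obtain ⟨x, hx⟩ := h.nonempty n
    obtain ⟨v, hv, l, hl, rfl⟩ := hn hx
    refine ⟨v, (h.mem_iff n _ hx v).2 ?_, interior_subset hv⟩
    simpa using L.inv_mem hl
  obtain ⟨c, hcC, hcV⟩ := exists_selection_eventually_mem hV.antitone h.nonempty hmeet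
  have hsub : ∀ n, {y | (c n)⁻¹ * y ∈ L ⊓ hV.core} ⊆ C n := fun n y hy =>
    (h.mem_iff n _ (hcC n) y).2 hy.1
  refine ⟨fun n => {y | (c n)⁻¹ * y ∈ L ⊓ hV.core}, ⟨h.isClosed.inter hV.isClosed_core,
    fun n => ⟨c n, by simp [one_mem]⟩, fun n x hx y => ?_, fun O hO hLO => ?_⟩, hsub⟩
  · have : (c n)⁻¹ * y = ((c n)⁻¹ * x) * (x⁻¹ * y) := by group
    rw [mem_ofPred_eq, this]
    exact Subgroup.mul_mem_cancel_left _ hx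
  · obtain ⟨k, hk⟩ : ∃ k, (L : Set N) ∩ V k ⊆ O := by
      refine exists_subset_nhds_of_isCompact (V := fun k => (L : Set N) ∩ V k)
        ?_ (fun k => (h.isClosed.inter (hV.isClosed k)).isCompact) fun x hx => ?_
      · exact Antitone.directed_ge fun i j hij => inter_subset_inter_right _ (hV.antitone hij)
      · exact hO.mem_nhds (hLO ⟨(mem_iInter.1 hx 0).1,
          hV.mem_core.2 fun n => (mem_iInter.1 hx n).2⟩)
    have hLU : (L : Set N) ⊆ O ∪ (V k)ᶜ := fun x hx => by
      by_cases hxV : x ∈ V k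
      · exact Or.inl (hk ⟨hx, hxV⟩)
      · exact Or.inr hxV
    filter_upwards [h.eventually_subset _ (hO.union (hV.isClosed k).isOpen_compl) hLU,
      hcV (k + 1)] with n hn hcn y hy
    refine (hn (hsub n hy)).resolve_right fun hyV => hyV ?_
    simpa using hV.mul_mem k _ hcn _ (hV.mem_core.1 hy.2 (k + 1))

theorem CosetsTendsto.exists_minimal {L : Subgroup N} {C : ℕ → Set N} (h : CosetsTendsto L C) :
    ∃ (L' : Subgroup N) (C' : ℕ → Set N), CosetsTendsto L' C' ∧ (∀ n, C' n ⊆ C n) ∧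
      ∀ M D, CosetsTendsto M D → M ≤ L' → (∀ n, D n ⊆ C' n) → L' ≤ M := by
  -- Zorn in the reversed order: along a chain, intersect; compactness keeps the cosets nonempty and
  -- the convergence intact.
  let S : Set (Subgroup N × (ℕ → Set N))ᵒᵈ :=
    {p | CosetsTendsto (OrderDual.ofDual p).1 (OrderDual.ofDual p).2}
  obtain ⟨m, hm, hmax⟩ := zorn_le_nonempty₀ S (fun c hcS hc p₀ hp₀ => by
    have hdir : ∀ {β : Type _} (f : (Subgroup N × (ℕ → Set N))ᵒᵈ → Set β),
        (∀ p q, p ≤ q → f q ⊆ f p) → Directed (· ⊇ ·) fun p : c => f p := by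
      intro β f hf p q
      rcases hc.total p.2 q.2 with hpq | hqp
      · exact ⟨q, hf _ _ hpq, subset_rfl⟩
      · exact ⟨p, subset_rfl, hf _ _ hqp⟩
    have : Nonempty c := ⟨⟨p₀, hp₀⟩⟩
    let L₁ : Subgroup N := ⨅ p : c, (OrderDual.ofDual p.1).1
    let C₁ : ℕ → Set N := fun n => ⋂ p : c, (OrderDual.ofDual p.1).2 n
    have hL₁ : (L₁ : Set N) = ⋂ p : c, ((OrderDual.ofDual p.1).1 : Set N) := Subgroup.coe_iInf
    refine ⟨OrderDual.toDual (L₁, C₁), ⟨?_, fun n => ?_, fun n x hx y => ?_, fun O hO hLO => ?_⟩,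
      fun p hp => ⟨iInf_le _ (⟨p, hp⟩ : c), fun n => iInter_subset _ (⟨p, hp⟩ : c)⟩⟩
    · show IsClosed (L₁ : Set N)
      rw [hL₁]
      exact isClosed_iInter fun p => (hcS p.2).isClosed
    · exact IsCompact.nonempty_iInter_of_directed_nonempty_isCompact_isClosed _
        (hdir (fun p => (OrderDual.ofDual p).2 n) fun p q hpq => hpq.2 n)
        (fun p => (hcS p.2).nonempty n) (fun p => ((hcS p.2).isClosed_coset n).isCompact)
        fun p => (hcS p.2).isClosed_coset n
    · show y ∈ C₁ n ↔ x⁻¹ * y ∈ L₁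
      rw [Subgroup.mem_iInf, mem_iInter]
      exact forall_congr' fun p => (hcS p.2).mem_iff n x (mem_iInter.1 hx p) y
    · obtain ⟨p, hp⟩ := exists_subset_nhds_of_isCompact
        (V := fun p : c => ((OrderDual.ofDual p.1).1 : Set N))
        (hdir (fun p => ((OrderDual.ofDual p).1 : Set N)) fun p q hpq => hpq.1)
        (fun p => (hcS p.2).isClosed.isCompact)
        (U := O) fun x hx => hO.mem_nhds (hLO (hL₁ ▸ hx))
      filter_upwards [(hcS p.2).eventually_subset O hO hp] with n hn
      exact (iInter_subset _ p).trans hn) (OrderDual.toDual (L, C)) h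
  refine ⟨(OrderDual.ofDual m).1, (OrderDual.ofDual m).2, hmax.prop, hm.2, fun M D hMD hM hD => ?_⟩
  exact (hmax.le_of_ge (y := OrderDual.toDual (M, D)) hMD ⟨hM, hD⟩).1

/-- Every infinite compact Hausdorff group contains a nontrivial convergent sequence. -/
theorem exists_tendsto_one_of_infinite_compact_group (N : Type*) [Group N] [TopologicalSpace N]
    [IsTopologicalGroup N] [CompactSpace N] [T2Space N] [Infinite N] :
    ∃ a : ℕ → N, (∀ n, a n ≠ 1) ∧ Tendsto a atTop (𝓝 1) := by
  have hnd : ∀ U ∈ 𝓝 (1 : N), ∃ x ∈ U, x ≠ 1 := by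
    intro U hU
    by_contra! hcon
    have h1 : IsOpen ({1} : Set N) := isOpen_singleton_iff_nhds_eq_pure 1 |>.2 <|
      le_antisymm (le_pure_iff.2 (mem_of_superset hU hcon)) (pure_le_nhds 1)
    have : DiscreteTopology N := discreteTopology_of_isOpen_singleton_one h1
    exact not_finite_iff_infinite.2 ‹Infinite N› finite_of_compact_of_discrete
  choose! x hxU hx1 using hnd
  obtain ⟨V, hV, hVx⟩ := exists_isSquareRootSeq (fun _ U => {x U}ᶜ) fun _ U hU =>
    isOpen_compl_singleton.mem_nhds (hx1 U hU).symm
  have ha : ∀ n, x (V n) ∉ hV.core := fun n hn => hVx n (hV.mem_core.1 hn (n + 1)) rfl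
  -- These cosets tend to the core but never equal it, so no selection from them takes the value
  -- `1`.
  have h₀ : CosetsTendsto hV.core fun n => {y | (x (V n))⁻¹ * y ∈ hV.core} := by
    refine ⟨hV.isClosed_core, fun n => ⟨x (V n), by simp [one_mem]⟩, fun n z hz y => ?_,
      fun O hO hLO => ?_⟩
    · have : (x (V n))⁻¹ * y = ((x (V n))⁻¹ * z) * (z⁻¹ * y) := by group
      rw [mem_ofPred_eq, this]
      exact Subgroup.mul_mem_cancel_left _ hz
    · obtain ⟨k, hk⟩ := exists_subset_nhds_of_isCompact (V := V)
        hV.antitone.directed_ge (fun k => (hV.isClosed k).isCompact)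
        (U := O) fun z hz => hO.mem_nhds (hLO hz)
      filter_upwards [eventually_ge_atTop (k + 1)] with n hn y hy
      apply hk
      simpa using hV.mul_mem k _ (hV.antitone hn (hxU _ (hV.mem_nhds n))) _
        (hV.mem_core.1 hy (k + 1))
  obtain ⟨L, C, hLC, hCsub, hmin⟩ := h₀.exists_minimal
  -- A nontrivial `g ∈ L` could be cut away by a refinement, against minimality.
  have hL : ∀ g ∈ L, g = 1 := by
    intro g hg
    by_contra hg1
    obtain ⟨W, hW, hWg⟩ := exists_isSquareRootSeq_core_subset (fun _ => ({g}ᶜ : Set N))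
      fun _ => isOpen_compl_singleton.mem_nhds (Ne.symm hg1)
    obtain ⟨D, hD, hDC⟩ := hLC.exists_refinement hW
    exact mem_iInter.1 (hWg (hmin _ D hD inf_le_left hDC hg).2) 0 rfl
  choose c hc using hLC.nonempty
  refine ⟨c, fun n hn => ha n ?_, ?_⟩
  · have := hCsub n (hc n)
    rw [mem_ofPred_eq, hn, mul_one] at this
    simpa using this
  · rw [tendsto_nhds]
    intro O hO h1
    filter_upwards [hLC.eventually_subset O hO fun g hg => hL g hg ▸ h1] with n hn
    exact hn (hc n)

end CompactGroup

/-! ### From an infinite compact set to metrizability -/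

section

variable {G : Type*} [Group G] [TopologicalSpace G] [IsTopologicalGroup G] [T1Space G]

theorem exists_iInter_nhds_one_subset_singleton [CompletelyNormalSpace G] {K : Set G}
    (hK : IsCompact K) (hinf : K.Infinite) :
    ∃ O : ℕ → Set G, (∀ n, O n ∈ 𝓝 (1 : G)) ∧ ⋂ n, O n ⊆ {1} := by
  obtain ⟨D, hDK, hDinf, hDc⟩ : ∃ D ⊆ K, D.Infinite ∧ D.Countable := by
    refine ⟨range fun n => (hinf.natEmbedding K n : G), ?_, ?_, countable_range _⟩
    · rintro _ ⟨n, rfl⟩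
      exact (hinf.natEmbedding K n).2
    · exact infinite_range_of_injective
        (Subtype.val_injective.comp (hinf.natEmbedding K).injective)
  obtain ⟨x, -, hx⟩ := hDinf.exists_accPt_of_subset_isCompact hK hDK
  let φ := Homeomorph.mulLeft x⁻¹
  have hφ : ∀ y, φ y = x⁻¹ * y := fun _ => rfl
  have hB1 : (1 : G) ∈ closure (φ '' (D \ {x})) := by
    rw [← φ.image_closure]
    exact ⟨x, mem_closure_iff_clusterPt.2 (accPt_principal_iff_clusterPt.1 hx), by simp [hφ]⟩
  have hB1' : (1 : G) ∉ φ '' (D \ {x}) := by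
    rintro ⟨y, hy, hxy⟩
    rw [hφ, inv_mul_eq_one] at hxy
    exact hy.2 hxy.symm
  have hcl : IsCompact (closure (φ '' (D \ {x}))) :=
    (hK.image φ.continuous).closure_of_subset (image_mono (sdiff_subset.trans hDK))
  obtain ⟨O, hO, hOB⟩ := exists_iInter_nhds_one_subset_closure
    ((hDc.mono sdiff_subset).image φ) hB1 hB1'
  obtain ⟨V, hV, hVO⟩ := exists_isSquareRootSeq_core_subset O hO
  have hcomp : IsCompact (hV.core : Set G) :=
    hcl.of_isClosed_subset hV.isClosed_core (hVO.trans (hOB.trans sdiff_subset))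
  by_cases hfin : (hV.core : Set G).Finite
  -- A finite core is reduced to `1` by deleting its other points.
  · refine ⟨fun n => V n ∩ ((hV.core : Set G) \ {1})ᶜ, fun n => inter_mem (hV.mem_nhds n) ?_, ?_⟩
    · exact (hfin.subset sdiff_subset).isClosed.isOpen_compl.mem_nhds (by simp)
    · intro y hy
      by_contra hy1
      exact (mem_iInter.1 hy 0).2 ⟨hV.mem_core.2 fun n => (mem_iInter.1 hy n).1, hy1⟩
  · have : CompactSpace hV.core := isCompact_iff_compactSpace.1 hcomp
    have : Infinite hV.core := infinite_coe_iff.2 hfin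
    obtain ⟨a, ha1, ha⟩ := exists_tendsto_one_of_infinite_compact_group hV.core
    have ha' : Tendsto (fun n => (a n : G)) atTop (𝓝 1) :=
      (continuous_subtype_val.tendsto (1 : hV.core)).comp ha
    have hB : (1 : G) ∉ range fun n => (a n : G) := by
      rintro ⟨n, hn⟩
      exact ha1 n (Subtype.ext hn)
    obtain ⟨O', hO', hsub⟩ := exists_iInter_nhds_one_subset_closure (countable_range _)
      (mem_closure_of_tendsto ha' (Eventually.of_forall fun n => mem_range_self n)) hB
    refine ⟨O', hO', fun y hy => ?_⟩
    have := closure_minimal (subset_insert _ _) ha'.isCompact_insert_range.isClosed (hsub hy).1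
    exact this.resolve_right (hsub hy).2

theorem IsCompact.metrizableSpace_of_iInter_nhds_one {K : Set G} (hK : IsCompact K) {O : ℕ → Set G}
    (hO : ∀ n, O n ∈ 𝓝 (1 : G)) (hO1 : ⋂ n, O n ⊆ {1}) : TopologicalSpace.MetrizableSpace K := by
  obtain ⟨V, hV, hVO⟩ := exists_isSquareRootSeq_core_subset O hO
  have : CompactSpace K := isCompact_iff_compactSpace.1 hK
  let d : K × K → G := fun p => (p.1 : G)⁻¹ * p.2
  have hd : Continuous d := by fun_prop
  let _ : UniformSpace K := uniformSpaceOfCompactR1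
  -- The closed sets `d ⁻¹' V n` decrease to the diagonal, so by compactness they enter each of its
  -- neighbourhoods.
  have hbasis : (uniformity K).HasBasis (fun _ : ℕ => True) fun n => d ⁻¹' V n := by
    refine ⟨fun s => ⟨fun hs => ?_, ?_⟩⟩
    · rw [← nhdsSet_diagonal_eq_uniformity] at hs
      obtain ⟨n, hn⟩ := exists_subset_nhds_of_isCompact (V := fun n => d ⁻¹' V n)
        (Antitone.directed_ge fun i j hij => preimage_mono (hV.antitone hij))
        (fun n => ((hV.isClosed n).preimage hd).isCompact)
        (U := s) fun p hp => by
          have hp1 : d p = 1 := hO1 (hVO (hV.mem_core.2 fun n => mem_iInter.1 hp n))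
          have : p ∈ diagonal K := Subtype.ext (inv_mul_eq_one.1 hp1)
          exact mem_nhdsSet_iff_forall.1 hs p this
      exact ⟨n, trivial, hn⟩
    · rintro ⟨n, -, hn⟩
      rw [← nhdsSet_diagonal_eq_uniformity]
      refine mem_of_superset (mem_nhdsSet_iff_forall.2 ?_) hn
      rintro ⟨p, q⟩ (rfl : p = q)
      refine hd.continuousAt ?_
      simpa [d] using hV.mem_nhds n
  have : (uniformity K).IsCountablyGenerated := hbasis.isCountablyGenerated
  exact UniformSpace.metrizableSpace

end

theorem theorem2p9 {G : Type*} [Group G] [TopologicalSpace G] [IsTopologicalGroup G]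
    [T1Space G] (hG : ∀ s : Set G, NormalSpace s) (K : Set G) (hK : IsCompact K) :
    TopologicalSpace.MetrizableSpace K := by
  by_cases hfin : K.Finite
  · have : Finite K := hfin
    infer_instance
  · have : CompletelyNormalSpace G := .of_forall_normalSpace hG
    obtain ⟨O, hO, hO1⟩ := exists_iInter_nhds_one_subset_singleton hK hfin
    exact hK.metrizableSpace_of_iInter_nhds_one hO hO1
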